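/- Let $d\ge 1$, let $\Omega\subset\mathbb R^d$ be a bounded Lipschitz domain (any bounded open set is allowed), let $\|\cdot\|$ be the $L^2(\Omega)$-norm, and let $C_\Omega$ be the embedding (Poincaré) constant of $\Omega$, that is, the least $C\ge 0$ with $\|v\|\le C\|\nabla v\|$ for all $v\in H^1_0(\Omega)$, which exists. Let $\alpha\in(0,1)$ and $\sigma=1-\alpha/2$. Let $\varepsilon>0$ and $0<\Delta t<T_{\rm soe}$, and let $N_q\ge1$, nodes $\theta^\ell>0$ and weights $\varpi^\ell>0$ $(1\le \ell\le N_q)$ be such that $$\Big|s^{-\alpha}-\sum_{\ell=1}^{N_q}\varpi^\ell e^{-\theta^\ell s}\Big|\le\varepsilon\qquad\text{for all } s\in[\Delta t,T_{\rm soe}].$$ Let $0=t_0<t_1<t_2<\cdots$ be a time mesh with steps $\tau_k=t_k-t_{k-1}$, let $t_k^*=t_{k-1}+\sigma\tau_k$, and let $\eta\approx0.475329$ be the unique positive root of $1-3\rho^2(1+\rho)=0$. Assume that $$\frac{\tau_k}{\tau_{k-1}}\ge\eta\ (k\ge2),\quad \varepsilon\le\frac{1}{5(1-\alpha)(\sigma\tau_k)^\alpha}\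 (k\ge1),\quad \Delta t\le\sigma\tau_k\ (k\ge2),\quad T_{\rm soe}\ge\sigma\tau_{k+1}+\tau_k\ (k\ge2).$$ For a sequence $u=(u^k)_{k\ge0}$ and $k\ge1$ define $$F_k^{\alpha,*}u=\frac1{\Gamma(1-\alpha)}\Big(\sum_{j=1}^{k-1}\int_{t_{j-1}}^{t_j}\partial_s\Pi_{2,j}(s)\sum_{\ell=1}^{N_q}\varpi^\ell e^{-\theta^\ell(t_k^*-s)}\,ds+\int_{t_{k-1}}^{t_k^*}\frac{\partial_s\Pi_{1,k}(s)}{(t_k^*-s)^{\alpha}}\,ds\Big),$$ where $\Pi_{2,j}$ is the quadratic interpolant of $u^{j-1},u^j,u^{j+1}$ at $t_{j-1},t_j,t_{j+1}$ and $\Pi_{1,k}$ is the linear interpolant of $u^{k-1},u^k$ at $t_{k-1},t_k$. Let $u^0\in H^1_0(\Omega)$, let $f\in L^\infty([0,\infty);L^2(\Omega))$ be of bounded variation as a function $[0,\infty)\to L^2(\Omega)$, and let $$C_f=2\|f\|_{L^\infty([0,\infty);L^2(\Omega))}+\|f\|_{BV([0,\infty);L^2(\Omega))},$$ where $\|f\|_{L^\infty}$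 is the essential supremum of $\|f(t)\|$ and $\|f\|_{BV}$ is the total variation of $f$ on $[0,\infty)$. If $u^k\in H^1_0(\Omega)$ $(k\ge1)$ solve (in the weak sense, tested with $H^1_0(\Omega)$) the fast L2-1$_\sigma$ scheme for the linear subdiffusion equation $\partial_t^\alpha u=\Delta u+f$ with homogeneous Dirichlet data, $$F_k^{\alpha,*}u=(1-\alpha/2)\,\Delta u^k+(\alpha/2)\,\Delta u^{k-1}+f(t_k^*)\ \text{ in }\Omega,\qquad u^k=0\ \text{ on }\partial\Omega,\qquad k\ge1,$$ then $$\|\nabla u^n\|\le\|\nabla u^0\|+2C_fC_\Omega\qquad\text{for all } n\ge1.$$ -/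

import Mathlib

open MeasureTheory Set
open scoped ContDiff

noncomputable section

namespace Subdiffusion

/-- The space `ℝ^d` with its Euclidean norm. -/
abbrev Space (d : ℕ) : Type := EuclideanSpace ℝ (Fin d)

/-- The real Hilbert space `L²(Ω)`. -/
abbrev L2 {d : ℕ} (Ω : Set (Space d)) : Type := Lp ℝ 2 (volume.restrict Ω)

/-- The real Hilbert space `L²(Ω; ℝ^d)` of square integrable vector fields. -/
abbrev L2Vec {d : ℕ} (Ω : Set (Space d)) : Type := Lp (Space d) 2 (volume.restrict Ω)

/-- `φ` is a test function on `Ω`, that is, `φ ∈ C_c^∞(Ω)`. -/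
structure IsTestFunction {d : ℕ} (Ω : Set (Space d)) (φ : Space d → ℝ) : Prop where
  smooth : ContDiff ℝ ∞ φ
  compact : HasCompactSupport φ
  subset : tsupport φ ⊆ Ω

/-- The pairs `(φ, ∇φ)` in `L²(Ω) × L²(Ω; ℝ^d)` with `φ ∈ C_c^∞(Ω)`. -/
def testGraph {d : ℕ} (Ω : Set (Space d)) : Submodule ℝ (L2 Ω × L2Vec Ω) where
  carrier := {p | ∃ φ : Space d → ℝ, IsTestFunction Ω φ ∧
    p.1 =ᵐ[volume.restrict Ω] φ ∧ p.2 =ᵐ[volume.restrict Ω] gradient φ}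
  zero_mem' := by
    refine ⟨fun _ => 0, ⟨contDiff_const, HasCompactSupport.zero, ?_⟩, ?_, ?_⟩
    · have h : (fun _ : Space d => (0 : ℝ)) = 0 := rfl
      rw [h, tsupport_eq_empty_iff.2 rfl]
      exact empty_subset Ω
    · exact Lp.coeFn_zero _ _ _
    · filter_upwards [Lp.coeFn_zero (Space d) 2 (volume.restrict Ω)] with x hx
      simpa [gradient] using hx
  add_mem' := by
    rintro p q ⟨φ, hφ, hp1, hp2⟩ ⟨ψ, hψ, hq1, hq2⟩
    refine ⟨φ + ψ, ⟨hφ.smooth.add hψ.smooth, hφ.compact.add hψ.compact, ?_⟩, ?_, ?_⟩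
    · exact (tsupport_add φ ψ).trans (union_subset hφ.subset hψ.subset)
    · filter_upwards [Lp.coeFn_add p.1 q.1, hp1, hq1] with x hx h1 h2
      simpa [h1, h2] using hx
    · filter_upwards [Lp.coeFn_add p.2 q.2, hp2, hq2] with x hx h1 h2
      have e : fderiv ℝ (φ + ψ) x = fderiv ℝ φ x + fderiv ℝ ψ x :=
        fderiv_add (hφ.smooth.differentiable (by simp) x) (hψ.smooth.differentiable (by simp) x)
      simpa [h1, h2, gradient, e] using hx
  smul_mem' := by
    rintro c p ⟨φ, hφ, hp1, hp2⟩
    refine ⟨c • φ, ⟨contDiff_const.smul hφ.smooth, hφ.compact.smul_left, ?_⟩, ?_, ?_⟩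
    · exact (closure_mono (Function.support_const_smul_subset c φ)).trans hφ.subset
    · filter_upwards [Lp.coeFn_smul c p.1, hp1] with x hx h1
      simp [hx, h1]
    · filter_upwards [Lp.coeFn_smul c p.2, hp2] with x hx h1
      have e : fderiv ℝ (c • φ) x = c • fderiv ℝ φ x :=
        fderiv_const_smul (hφ.smooth.differentiable (by simp) x) c
      simp [hx, h1, gradient, e]

/-- The Sobolev space `H¹₀(Ω)`, the closure of `C_c^∞(Ω)` in `H¹(Ω)`. Its elements are written as
pairs `(u, ∇u)` with `u ∈ L²(Ω)` and `∇u ∈ L²(Ω; ℝ^d)` the weak gradient (an `L²`-limit of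
gradients is the weak gradient of the limit, so `∇u` is determined by `u`). -/
def H10 {d : ℕ} (Ω : Set (Space d)) : Submodule ℝ (L2 Ω × L2Vec Ω) :=
  (testGraph Ω).topologicalClosure

/-- The `L²(Ω)` function underlying an element of `H¹₀(Ω)`. -/
def H10.fn {d : ℕ} {Ω : Set (Space d)} (u : H10 Ω) : L2 Ω := (u : L2 Ω × L2Vec Ω).1

/-- The weak gradient of an element of `H¹₀(Ω)`. -/
def H10.grad {d : ℕ} {Ω : Set (Space d)} (u : H10 Ω) : L2Vec Ω := (u : L2 Ω × L2Vec Ω).2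

/-- `C` is the constant of the embedding of `H¹₀(Ω)`, with norm `‖∇v‖`, into `L²(Ω)`:
the least `C ≥ 0` with `‖v‖ ≤ C ‖∇v‖` for all `v ∈ H¹₀(Ω)`. -/
def IsEmbeddingConstant {d : ℕ} (Ω : Set (Space d)) (C : ℝ) : Prop :=
  IsLeast {c : ℝ | 0 ≤ c ∧ ∀ v : H10 Ω, ‖H10.fn v‖ ≤ c * ‖H10.grad v‖} C

/-- The sum of exponentials `∑_ℓ ϖ^ℓ exp (-θ^ℓ t)`. -/
def expSum {Nq : ℕ} (θ ϖ : Fin Nq → ℝ) (t : ℝ) : ℝ :=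
  ∑ l, ϖ l * Real.exp (-θ l * t)

/-- The positive nodes `θ^ℓ` and positive weights `ϖ^ℓ` give a sum-of-exponentials approximation
of `t^{-α}` on `[Δt, Tsoe]` with absolute error at most `ε`. -/
structure IsSOE (α ε Δt Tsoe : ℝ) {Nq : ℕ} (θ ϖ : Fin Nq → ℝ) : Prop where
  tol_pos : 0 < ε
  cutoff_pos : 0 < Δt
  cutoff_lt : Δt < Tsoe
  card_pos : 0 < Nq
  node_pos : ∀ l, 0 < θ l
  weight_pos : ∀ l, 0 < ϖ l
  approx : ∀ t ∈ Icc Δt Tsoe, |t ^ (-α) - expSum θ ϖ t| ≤ ε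

/-- The step `τ_k = t_k - t_{k-1}`, for `k ≥ 1`. -/
def step (t : ℕ → ℝ) (k : ℕ) : ℝ := t k - t (k - 1)

/-- The parameter `σ = 1 - α/2`. -/
def sig (α : ℝ) : ℝ := 1 - α / 2

/-- The shifted point `t_k^* = t_{k-1} + σ τ_k`, for `k ≥ 1`. -/
def tStar (α : ℝ) (t : ℕ → ℝ) (k : ℕ) : ℝ := t (k - 1) + sig α * step t k

/-- The conditions on the mesh `0 = t_0 < t_1 < …`; `η` is the lower bound of the step ratios
`ρ_k = τ_k / τ_{k-1}`. -/
structure IsAdmissibleMesh (α η ε Δt Tsoe : ℝ) (t : ℕ → ℝ) : Prop where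
  zero : t 0 = 0
  lt_succ : ∀ k, t k < t (k + 1)
  ratio : ∀ k, 2 ≤ k → η ≤ step t k / step t (k - 1)
  tol_le : ∀ k, 1 ≤ k → ε ≤ 1 / (5 * (1 - α) * (sig α * step t k) ^ α)
  cutoff_le : ∀ k, 2 ≤ k → Δt ≤ sig α * step t k
  le_soe : ∀ k, 2 ≤ k → sig α * step t (k + 1) + step t k ≤ Tsoe

section Interpolation

variable {V : Type*} [NormedAddCommGroup V] [NormedSpace ℝ V]

/-- The linear interpolant `Π_{1,k}` of `u^{k-1}, u^k` at `t_{k-1}, t_k`, for `k ≥ 1`. -/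
def interp1 (t : ℕ → ℝ) (u : ℕ → V) (k : ℕ) (s : ℝ) : V :=
  ((s - t k) / (t (k - 1) - t k)) • u (k - 1) + ((s - t (k - 1)) / (t k - t (k - 1))) • u k

/-- The quadratic interpolant `Π_{2,j}` of `u^{j-1}, u^j, u^{j+1}` at `t_{j-1}, t_j, t_{j+1}`,
for `j ≥ 1`. -/
def interp2 (t : ℕ → ℝ) (u : ℕ → V) (j : ℕ) (s : ℝ) : V :=
  ((s - t j) * (s - t (j + 1)) / ((t (j - 1) - t j) * (t (j - 1) - t (j + 1)))) • u (j - 1) +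
  ((s - t (j - 1)) * (s - t (j + 1)) / ((t j - t (j - 1)) * (t j - t (j + 1)))) • u j +
  ((s - t (j - 1)) * (s - t j) / ((t (j + 1) - t (j - 1)) * (t (j + 1) - t j))) • u (j + 1)

/-- The fast L2-1σ operator `F_k^{α,*} u`, for `k ≥ 1`: in the history part, over `(0, t_{k-1})`,
the kernel `(t_k^* - s)^{-α}` is replaced by its sum-of-exponentials approximation. -/
def fastL21 (α : ℝ) {Nq : ℕ} (θ ϖ : Fin Nq → ℝ) (t : ℕ → ℝ) (u : ℕ → V) (k : ℕ) : V :=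
  (Real.Gamma (1 - α))⁻¹ •
    ((∑ j ∈ Finset.Icc 1 (k - 1),
        ∫ s in (t (j - 1))..(t j), expSum θ ϖ (tStar α t k - s) • deriv (interp2 t u j) s) +
      ∫ s in (t (k - 1))..(tStar α t k),
        ((tStar α t k - s) ^ (-α)) • deriv (interp1 t u k) s)

end Interpolation

/-- `u^0, u^1, … ∈ H¹₀(Ω)` solves the fast L2-1σ scheme with initial value `u0` and source `f`:
`F_k^{α,*} u = (1-α/2) Δu^k + (α/2) Δu^{k-1} + f(t_k^*)` in `Ω`, `u^k = 0` on `∂Ω`, for all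
`k ≥ 1`. As `u0` is only in `H¹₀(Ω)`, the equation is meant in the usual weak sense. -/
structure IsFastSolution {d : ℕ} {Ω : Set (Space d)} (α : ℝ) {Nq : ℕ} (θ ϖ : Fin Nq → ℝ)
    (t : ℕ → ℝ) (f : ℝ → L2 Ω) (u0 : H10 Ω) (u : ℕ → H10 Ω) : Prop where
  initial : u 0 = u0
  equation : ∀ k, 1 ≤ k → ∀ v : H10 Ω,
    inner ℝ (fastL21 α θ ϖ t (fun j => H10.fn (u j)) k) (H10.fn v) =
      -(1 - α / 2) * inner ℝ (H10.grad (u k)) (H10.grad v) - α / 2 * inner ℝ (H10.grad (u (k - 1))) (H10.grad v) +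
        inner ℝ (f (tStar α t k)) (H10.fn v)

/-- `C_f = 2 ‖f‖_{L^∞([0,∞); L²(Ω))} + ‖f‖_{BV([0,∞); L²(Ω))}`, with the essential supremum norm
and the total variation in time. -/
def sourceConst {d : ℕ} {Ω : Set (Space d)} (f : ℝ → L2 Ω) : ℝ :=
  2 * (eLpNorm f ⊤ (volume.restrict (Ici 0))).toReal + (eVariationOn f (Ici 0)).toReal

end Subdiffusion

end

/-! Test the scheme with the increment u^k - u^{k-1} and sum over k. The diffusion terms telescope
to half the change of ‖∇u‖², up to a nonnegative remainder (`norm_sq_sub_le_theta_form`). Summation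
by parts moves the differences onto f, so the source costs at most C_f max‖u^k‖ ≤ C_f C_Ω max‖∇u^k‖
(`sum_inner_sub_le`). At an index maximizing ‖∇u^k‖ this is a quadratic inequality which gives the
bound.

The core is that the discrete fractional derivative is positive semidefinite on increments
(`sum_inner_fastL21_nonneg`). Its history coefficients are sums over ℓ of ϖ e^{-θ t_k^*} H_j. The
first factor decreases in k; the second increases in j, because e^{θ t_j} ≤ H_j ≤ e^{θ t_{j+1}}
(`exp_le_histCoef`, `histCoef_le_exp`). With a large enough diagonal, this monotonicity bounds the
quadratic form below by a sum of squares (`sum_sq_le_lowerTriangular_form`). The step ratio bound η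
is what gives the upper bound on H_j. The diagonal condition (`hist_zero_le_diagCoef`,
`hist_succ_le_diagCoef`) compares the exponential sum with the singular kernel, using the tolerance
bound and again η. -/

namespace Subdiffusion

/-! ### Positivity of lower triangular quadratic forms -/

section QuadraticForm

variable {V : Type*} [NormedAddCommGroup V] [InnerProductSpace ℝ V]

theorem sum_partialSum_smul_eq (e : ℕ → ℝ) (x : ℕ → V) (n : ℕ) :
    ∑ j ∈ Finset.range n, (∑ i ∈ Finset.range (j + 1), e i) • x j =
      ∑ i ∈ Finset.range n, e i • ∑ j ∈ Finset.Ico i n, x j := by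
  simp_rw [Finset.sum_smul, Finset.smul_sum]
  apply Finset.sum_comm'
  intro a b
  simp only [Finset.mem_range, Finset.mem_Ico]
  omega

/-- The partial sums of the quadratic form of a lower triangular matrix whose entries have
nonnegative second mixed differences are bounded below by a sum of squares. -/
theorem sum_sq_le_lowerTriangular_form (e : ℕ → ℕ → ℝ) (d : ℕ → ℝ) (x : ℕ → V)
    (hanti : ∀ n j, j < n → e (n + 1) j ≤ e n j)
    (hdiag : ∀ n, ∑ j ∈ Finset.range n, e n j + e (n + 1) n ≤ d n) (n : ℕ) :
    ∑ j ∈ Finset.range n, e n j * ‖∑ i ∈ Finset.Ico j n, x i‖ ^ 2 ≤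
      ∑ k ∈ Finset.range n, (d k * ‖x k‖ ^ 2 + 2 * inner ℝ (x k)
        (∑ j ∈ Finset.range k, (∑ i ∈ Finset.range (j + 1), e k i) • x j)) := by
  induction n with
  | zero => simp
  | succ n ih =>
    rw [Finset.sum_range_succ _ n, Finset.sum_range_succ _ n]
    have h1 : ∑ j ∈ Finset.range n, e (n + 1) j * ‖∑ i ∈ Finset.Ico j (n + 1), x i‖ ^ 2 ≤
        ∑ j ∈ Finset.range n, (e n j * ‖∑ i ∈ Finset.Ico j n, x i‖ ^ 2 +
          2 * (e n j * inner ℝ (x n) (∑ i ∈ Finset.Ico j n, x i)) + e n j * ‖x n‖ ^ 2) := by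
      refine Finset.sum_le_sum fun j hj => ?_
      have hj' := Finset.mem_range.1 hj
      calc e (n + 1) j * ‖∑ i ∈ Finset.Ico j (n + 1), x i‖ ^ 2
          ≤ e n j * ‖∑ i ∈ Finset.Ico j (n + 1), x i‖ ^ 2 :=
            mul_le_mul_of_nonneg_right (hanti n j hj') (sq_nonneg _)
        _ = _ := by
            rw [Finset.sum_Ico_succ_top hj'.le, norm_add_sq_real, real_inner_comm]
            ring
    rw [Finset.sum_add_distrib, Finset.sum_add_distrib, ← Finset.mul_sum, ← Finset.sum_mul] at h1
    have h2 : inner ℝ (x n) (∑ j ∈ Finset.range n, (∑ i ∈ Finset.range (j + 1), e n i) • x j) =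
        ∑ j ∈ Finset.range n, e n j * inner ℝ (x n) (∑ i ∈ Finset.Ico j n, x i) := by
      rw [sum_partialSum_smul_eq, inner_sum]
      exact Finset.sum_congr rfl fun j _ => by rw [real_inner_smul_right]
    -- The diagonal pays for every ‖x n‖²: those from expanding the old squares, and the new square
    -- j = n, whose weight is already that of row n + 1.
    have h3 := mul_le_mul_of_nonneg_right (hdiag n) (sq_nonneg ‖x n‖)
    rw [h2]
    simp only [Nat.Ico_succ_singleton, Finset.sum_singleton]
    linarith

theorem lowerTriangular_form_nonneg (e : ℕ → ℕ → ℝ) (d : ℕ → ℝ) (x : ℕ → V)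
    (hnonneg : ∀ n j, j < n → 0 ≤ e n j)
    (hanti : ∀ n j, j < n → e (n + 1) j ≤ e n j)
    (hdiag : ∀ n, ∑ j ∈ Finset.range n, e n j + e (n + 1) n ≤ d n) (n : ℕ) :
    0 ≤ ∑ k ∈ Finset.range n, (d k * ‖x k‖ ^ 2 + 2 * inner ℝ (x k)
        (∑ j ∈ Finset.range k, (∑ i ∈ Finset.range (j + 1), e k i) • x j)) :=
  (Finset.sum_nonneg fun j hj =>
    mul_nonneg (hnonneg n j (Finset.mem_range.1 hj)) (sq_nonneg _)).trans
    (sum_sq_le_lowerTriangular_form e d x hanti hdiag n)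

end QuadraticForm

/-! ### Moments of an exponential over one mesh cell -/

section ExponentialMoments

variable {θ a b : ℝ}

/-- The integral of `exp (θ s)` over `[a, b]`. -/
noncomputable def expMass (θ a b : ℝ) : ℝ := ∫ s in a..b, Real.exp (θ * s)

/-- The first moment of `exp (θ s)` about the midpoint of `[a, b]`, doubled. -/
noncomputable def expSkew (θ a b : ℝ) : ℝ := ∫ s in a..b, (2 * s - a - b) * Real.exp (θ * s)

theorem integral_sub_mul_sub (a b : ℝ) : ∫ s in a..b, (s - a) * (b - s) = (b - a) ^ 3 / 6 := by
  have hd : ∀ s ∈ uIcc a b, HasDerivAt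
      (fun s : ℝ => (a + b) / 2 * s ^ 2 - s ^ 3 / 3 - a * b * s) ((s - a) * (b - s)) s := by
    intro s _
    have h := (((hasDerivAt_pow 2 s).const_mul ((a + b) / 2)).sub
      ((hasDerivAt_pow 3 s).div_const 3)).sub ((hasDerivAt_id s).const_mul (a * b))
    refine h.congr_deriv ?_
    simp
    ring
  rw [intervalIntegral.integral_eq_sub_of_hasDerivAt hd
    (Continuous.intervalIntegrable (by fun_prop) _ _)]
  ring

/-- Integration by parts: (s - a)(s - b) is a primitive of 2s - a - b vanishing at both ends. This
exposes the sign and the cubic size of the moment. -/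
theorem expSkew_eq (θ a b : ℝ) :
    expSkew θ a b = θ * ∫ s in a..b, (s - a) * (b - s) * Real.exp (θ * s) := by
  have hd : ∀ s ∈ uIcc a b, HasDerivAt
      (fun s : ℝ => (s - a) * (s - b) * Real.exp (θ * s))
      ((2 * s - a - b) * Real.exp (θ * s) - θ * ((s - a) * (b - s) * Real.exp (θ * s))) s := by
    intro s _
    have h := (((hasDerivAt_id s).sub_const a).mul ((hasDerivAt_id s).sub_const b)).mul
      (((hasDerivAt_id s).const_mul θ).exp)
    refine h.congr_deriv ?_
    simp
    ring
  have h := intervalIntegral.integral_eq_sub_of_hasDerivAt hd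
    (Continuous.intervalIntegrable (by fun_prop) _ _)
  rw [intervalIntegral.integral_sub (Continuous.intervalIntegrable (by fun_prop) _ _)
    (Continuous.intervalIntegrable (by fun_prop) _ _),
    intervalIntegral.integral_const_mul] at h
  simp only [sub_self, mul_zero, zero_mul] at h
  rw [expSkew]
  linarith

theorem expMass_add_expSkew (θ a b : ℝ) :
    2 * expMass θ a b + θ * expSkew θ a b =
      (b - a) * (Real.exp (θ * a) + Real.exp (θ * b)) := by
  have hd : ∀ s ∈ uIcc a b, HasDerivAt
      (fun s : ℝ => (2 * s - a - b) * Real.exp (θ * s))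
      (2 * Real.exp (θ * s) + θ * ((2 * s - a - b) * Real.exp (θ * s))) s := by
    intro s _
    have h := ((((hasDerivAt_id s).const_mul 2).sub_const a).sub_const b).mul
      (((hasDerivAt_id s).const_mul θ).exp)
    refine h.congr_deriv ?_
    simp
    ring
  have h := intervalIntegral.integral_eq_sub_of_hasDerivAt hd
    (Continuous.intervalIntegrable (by fun_prop) _ _)
  rw [intervalIntegral.integral_add (Continuous.intervalIntegrable (by fun_prop) _ _)
    (Continuous.intervalIntegrable (by fun_prop) _ _),
    intervalIntegral.integral_const_mul, intervalIntegral.integral_const_mul] at h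
  rw [expMass, expSkew, h]
  ring

theorem expSkew_nonneg (hθ : 0 ≤ θ) (hab : a ≤ b) : 0 ≤ expSkew θ a b := by
  rw [expSkew_eq]
  refine mul_nonneg hθ (intervalIntegral.integral_nonneg hab fun s hs => ?_)
  exact mul_nonneg (mul_nonneg (sub_nonneg.2 hs.1) (sub_nonneg.2 hs.2)) (Real.exp_nonneg _)

theorem expSkew_le (hθ : 0 ≤ θ) (hab : a ≤ b) :
    expSkew θ a b ≤ θ * Real.exp (θ * b) * ((b - a) ^ 3 / 6) := by
  rw [expSkew_eq, ← integral_sub_mul_sub, mul_assoc, ← intervalIntegral.integral_const_mul (Real.exp (θ * b))]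
  refine mul_le_mul_of_nonneg_left (intervalIntegral.integral_mono_on hab
    (Continuous.intervalIntegrable (by fun_prop) _ _)
    (Continuous.intervalIntegrable (by fun_prop) _ _) fun s hs => ?_) hθ
  rw [mul_comm]
  exact mul_le_mul_of_nonneg_right (Real.exp_le_exp.2 (mul_le_mul_of_nonneg_left hs.2 hθ))
    (mul_nonneg (sub_nonneg.2 hs.1) (sub_nonneg.2 hs.2))

theorem expMass_le_trapezoid (hθ : 0 ≤ θ) (hab : a ≤ b) :
    expMass θ a b ≤ (b - a) * (Real.exp (θ * a) + Real.exp (θ * b)) / 2 := by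
  have h := expMass_add_expSkew θ a b
  have h' := mul_nonneg hθ (expSkew_nonneg hθ hab)
  linarith

theorem integral_sub_left (a b : ℝ) : ∫ s in a..b, (b - s) = (b - a) ^ 2 / 2 := by
  rw [intervalIntegral.integral_sub (by simp) (by simp)]
  simp
  ring

/-- The combined weight 1 - (2s - a - b)/(b - a) equals 2(b - s)/(b - a), which is nonnegative with
integral b - a. -/
theorem mul_exp_le_expMass_sub_expSkew (hθ : 0 ≤ θ) (hab : a < b) :
    (b - a) * Real.exp (θ * a) ≤ expMass θ a b - expSkew θ a b / (b - a) := by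
  have hb : 0 < b - a := sub_pos.2 hab
  have h1 : expMass θ a b - expSkew θ a b / (b - a) =
      2 / (b - a) * ∫ s in a..b, (b - s) * Real.exp (θ * s) := by
    rw [expMass, expSkew, ← intervalIntegral.integral_div, ← intervalIntegral.integral_sub
      (Continuous.intervalIntegrable (by fun_prop) _ _)
      (Continuous.intervalIntegrable (by fun_prop) _ _), ← intervalIntegral.integral_const_mul]
    refine intervalIntegral.integral_congr fun s _ => ?_
    field_simp
    ring
  have h2 : (b - a) ^ 2 / 2 * Real.exp (θ * a) ≤ ∫ s in a..b, (b - s) * Real.exp (θ * s) := by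
    rw [← integral_sub_left, ← intervalIntegral.integral_mul_const]
    refine intervalIntegral.integral_mono_on hab.le
      (Continuous.intervalIntegrable (by fun_prop) _ _)
      (Continuous.intervalIntegrable (by fun_prop) _ _) fun s hs => ?_
    exact mul_le_mul_of_nonneg_left (Real.exp_le_exp.2 (mul_le_mul_of_nonneg_left hs.1 hθ))
      (sub_nonneg.2 hs.2)
  rw [h1]
  calc (b - a) * Real.exp (θ * a) = 2 / (b - a) * ((b - a) ^ 2 / 2 * Real.exp (θ * a)) := by
        field_simp
    _ ≤ _ := mul_le_mul_of_nonneg_left h2 (by positivity)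

/-- Integrate e^{θb} ≥ e^{θs}(1 + θ(b - s)) ≥ e^{θs} + θ e^{θa}(b - s). The surplus over the mean is
kept because it must absorb `skewCoef`. -/
theorem expMass_add_le (hθ : 0 ≤ θ) (hab : a ≤ b) :
    expMass θ a b + θ * Real.exp (θ * a) * ((b - a) ^ 2 / 2) ≤ (b - a) * Real.exp (θ * b) := by
  have h : (b - a) * Real.exp (θ * b) = ∫ _ in a..b, Real.exp (θ * b) := by simp
  rw [h, ← integral_sub_left, ← intervalIntegral.integral_const_mul, expMass,
    ← intervalIntegral.integral_add (Continuous.intervalIntegrable (by fun_prop) _ _)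
      (Continuous.intervalIntegrable (by fun_prop) _ _)]
  refine intervalIntegral.integral_mono_on hab (Continuous.intervalIntegrable (by fun_prop) _ _)
    (Continuous.intervalIntegrable (by fun_prop) _ _) fun s hs => ?_
  have h1 : Real.exp (θ * a) ≤ Real.exp (θ * s) :=
    Real.exp_le_exp.2 (mul_le_mul_of_nonneg_left hs.1 hθ)
  have h2 : θ * (b - s) + 1 ≤ Real.exp (θ * (b - s)) := Real.add_one_le_exp _
  have h3 : Real.exp (θ * b) = Real.exp (θ * s) * Real.exp (θ * (b - s)) := by
    rw [← Real.exp_add]; ring_nf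
  have h4 : 0 ≤ θ * (b - s) := mul_nonneg hθ (sub_nonneg.2 hs.2)
  have h5 := mul_le_mul_of_nonneg_left h2 (Real.exp_nonneg (θ * s))
  have h6 := mul_le_mul_of_nonneg_right h1 h4
  rw [h3]
  linarith

end ExponentialMoments

/-! ### Poincaré inequality and existence of the embedding constant -/

section Poincare

variable {d : ℕ} {Ω : Set (Space d)}

theorem norm_sq_eq_integral {E : Type*} [NormedAddCommGroup E] [InnerProductSpace ℝ E]
    {μ : Measure (Space d)} (v : Lp E 2 μ) : ‖v‖ ^ 2 = ∫ x, ‖v x‖ ^ 2 ∂μ := by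
  rw [← real_inner_self_eq_norm_sq, L2.inner_def]
  simp_rw [real_inner_self_eq_norm_sq]

/-- Integrate φ² by parts against one coordinate function, which is bounded by R on Ω and has unit
derivative in its direction, then absorb half of ∫φ² by Young's inequality. -/
theorem IsTestFunction.integral_sq_le {φ : Space d → ℝ} (hφ : IsTestFunction Ω φ) (hd : 1 ≤ d)
    {R : ℝ} (hR : ∀ x ∈ Ω, ‖x‖ ≤ R) :
    ∫ x, φ x ^ 2 ≤ 4 * R ^ 2 * ∫ x, ‖gradient φ x‖ ^ 2 := by
  have i0 : Fin d := ⟨0, hd⟩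
  set e : Space d := EuclideanSpace.single i0 1 with he
  have hen : ‖e‖ = 1 := by simp [he]
  set X : Space d → ℝ := fun x => x i0 with hX
  have hXd : Differentiable ℝ X := by
    simp only [hX]; fun_prop
  have hX' : ∀ x, fderiv ℝ X x e = 1 := by
    intro x
    have : X = EuclideanSpace.proj (𝕜 := ℝ) i0 := by ext; simp [hX]
    rw [this, ContinuousLinearMap.fderiv]
    simp [he]
  have hφd : Differentiable ℝ φ := hφ.smooth.differentiable (by simp)
  have hφ' : Continuous (fderiv ℝ φ) := hφ.smooth.continuous_fderiv (by simp)
  have hφc := hφd.continuous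
  have hXc := hXd.continuous
  have hgc : Continuous (gradient φ) := by
    unfold gradient
    exact (InnerProductSpace.toDual ℝ (Space d)).symm.continuous.comp hφ'
  have hg : ∀ x, fderiv ℝ φ x e = inner ℝ (gradient φ x) e := by
    intro x; simp [gradient]
  have hφz : ∀ x, x ∉ tsupport φ → φ x = 0 := fun x hx => image_eq_zero_of_notMem_tsupport hx
  have hgz : ∀ x, x ∉ tsupport φ → gradient φ x = 0 := by
    intro x hx
    have h : fderiv ℝ φ x = 0 := by
      by_contra h
      exact hx (support_fderiv_subset ℝ h)
    simp [gradient, h]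
  have hint : ∀ F : Space d → ℝ, Continuous F → (∀ x, x ∉ tsupport φ → F x = 0) →
      Integrable F := fun F hF hz =>
    hF.integrable_of_hasCompactSupport (HasCompactSupport.intro hφ.compact hz)
  have hsq : ∀ x, fderiv ℝ (fun y => φ y ^ 2) x e = 2 * φ x * inner ℝ (gradient φ x) e := by
    intro x
    have h := ((hφd x).hasFDerivAt.pow 2).fderiv
    rw [← hg]
    rw [h]
    simp
  have key := integral_mul_fderiv_eq_neg_fderiv_mul_of_integrable (μ := volume)
    (f := fun y => φ y ^ 2) (g := X) (v := e)
    (by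
      simp_rw [hsq]
      refine hint _ (by fun_prop) fun x hx => by simp [hφz x hx])
    (by
      simp_rw [hX']
      refine hint _ (by fun_prop) fun x hx => by simp [hφz x hx])
    (by
      refine hint _ (by fun_prop) fun x hx => by simp [hφz x hx])
    (fun x _ => (hφd x).pow 2) (fun x _ => hXd x)
  simp_rw [hX', hsq, mul_one] at key
  rw [← integral_neg] at key
  have hle : ∫ x, φ x ^ 2 ≤ ∫ x, ((1 / 2) * φ x ^ 2 + 2 * R ^ 2 * ‖gradient φ x‖ ^ 2) := by
    rw [key]
    refine integral_mono (hint _ (by fun_prop) fun x hx => by simp [hφz x hx])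
      (hint _ (by fun_prop) fun x hx => by simp [hφz x hx, hgz x hx]) fun x => ?_
    by_cases hx : x ∈ tsupport φ
    · have h1 : |X x| ≤ R := (by simpa using PiLp.norm_apply_le x i0 : |X x| ≤ ‖x‖).trans
        (hR x (hφ.subset hx))
      have h2 : |inner ℝ (gradient φ x) e| ≤ ‖gradient φ x‖ := by
        simpa [hen] using abs_real_inner_le_norm (gradient φ x) e
      have h3 : |inner ℝ (gradient φ x) e * X x| ≤ R * ‖gradient φ x‖ := by
        rw [abs_mul, mul_comm]
        exact mul_le_mul h1 h2 (abs_nonneg _) ((abs_nonneg _).trans h1)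
      have h4 : (inner ℝ (gradient φ x) e * X x) ^ 2 ≤ (R * ‖gradient φ x‖) ^ 2 :=
        sq_le_sq' (neg_le_of_abs_le h3) (le_of_abs_le h3)
      simp only
      -- Young's inequality -2φy ≤ φ²/2 + 2y² with y = ∂_eφ · X.
      nlinarith [sq_nonneg (φ x + 2 * (inner ℝ (gradient φ x) e * X x))]
    · simp [hφz x hx, hgz x hx]
  rw [integral_add (hint _ (by fun_prop) fun x hx => by simp [hφz x hx])
    (hint _ (by fun_prop) fun x hx => by simp [hgz x hx]), integral_const_mul,
    integral_const_mul] at hle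
  linarith

theorem norm_le_of_mem_testGraph (hd : 1 ≤ d) {R : ℝ} (hR0 : 0 ≤ R) (hR : ∀ x ∈ Ω, ‖x‖ ≤ R)
    {p : L2 Ω × L2Vec Ω} (hp : p ∈ testGraph Ω) : ‖p.1‖ ≤ 2 * R * ‖p.2‖ := by
  obtain ⟨φ, hφ, h1, h2⟩ := hp
  have hz : ∀ x, x ∉ Ω → φ x = 0 := fun x hx =>
    image_eq_zero_of_notMem_tsupport fun h => hx (hφ.subset h)
  have hgz : ∀ x, x ∉ Ω → gradient φ x = 0 := by
    intro x hx
    have h : fderiv ℝ φ x = 0 := by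
      by_contra h
      exact hx (hφ.subset (support_fderiv_subset ℝ h))
    simp [gradient, h]
  have e1 : ‖p.1‖ ^ 2 = ∫ x, φ x ^ 2 := by
    rw [norm_sq_eq_integral, ← setIntegral_eq_integral_of_forall_compl_eq_zero (s := Ω)
      (f := fun x => φ x ^ 2) (fun x hx => by simp [hz x hx])]
    refine integral_congr_ae ?_
    filter_upwards [h1] with x hx
    simp [hx]
  have e2 : ‖p.2‖ ^ 2 = ∫ x, ‖gradient φ x‖ ^ 2 := by
    rw [norm_sq_eq_integral, ← setIntegral_eq_integral_of_forall_compl_eq_zero (s := Ω)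
      (f := fun x => ‖gradient φ x‖ ^ 2) (fun x hx => by simp [hgz x hx])]
    refine integral_congr_ae ?_
    filter_upwards [h2] with x hx
    simp [hx]
  refine (sq_le_sq₀ (norm_nonneg _) (by positivity)).1 ?_
  rw [mul_pow, e1, e2]
  refine (hφ.integral_sq_le hd hR).trans_eq ?_
  ring

theorem H10.norm_fn_le (hd : 1 ≤ d) {R : ℝ} (hR0 : 0 ≤ R) (hR : ∀ x ∈ Ω, ‖x‖ ≤ R) (v : H10 Ω) :
    ‖H10.fn v‖ ≤ 2 * R * ‖H10.grad v‖ := by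
  have hcl : IsClosed {p : L2 Ω × L2Vec Ω | ‖p.1‖ ≤ 2 * R * ‖p.2‖} :=
    isClosed_le (by fun_prop) (by fun_prop)
  exact closure_minimal (fun p hp => norm_le_of_mem_testGraph hd hR0 hR hp) hcl v.2

theorem exists_isEmbeddingConstant (hd : 1 ≤ d) (hbdd : Bornology.IsBounded Ω) :
    ∃ C, IsEmbeddingConstant Ω C := by
  obtain ⟨R, hR0, hR⟩ := hbdd.exists_pos_norm_le
  set S : Set ℝ := {c : ℝ | 0 ≤ c ∧ ∀ v : H10 Ω, ‖H10.fn v‖ ≤ c * ‖H10.grad v‖} with hS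
  have hne : S.Nonempty := ⟨2 * R, by positivity, H10.norm_fn_le hd hR0.le hR⟩
  have hbd : BddBelow S := ⟨0, fun c hc => hc.1⟩
  have hcl : IsClosed S := by
    rw [hS, ofPred_and, ofPred_forall]
    exact (isClosed_le continuous_const continuous_id).inter
      (isClosed_iInter fun v => isClosed_le continuous_const (by fun_prop))
  exact ⟨sInf S, hcl.csInf_mem hne hbd, fun c hc => csInf_le hbd hc⟩

end Poincare

/-! ### Source terms of bounded variation -/

section Source

variable {d : ℕ} {Ω : Set (Space d)}

theorem ae_norm_le_essSup {f : ℝ → L2 Ω} (hf : MemLp f ⊤ (volume.restrict (Ici 0))) :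
    ∀ᵐ s ∂volume.restrict (Ici (0 : ℝ)),
      ‖f s‖ ≤ (eLpNorm f ⊤ (volume.restrict (Ici 0))).toReal := by
  rw [eLpNorm_exponent_top]
  filter_upwards [ae_le_eLpNormEssSup (f := f) (μ := volume.restrict (Ici (0 : ℝ)))] with s hs
  have hfin : eLpNormEssSup f (volume.restrict (Ici 0)) ≠ ⊤ := by
    rw [← eLpNorm_exponent_top]; exact hf.2.ne
  simpa using ENNReal.toReal_mono hfin hs

theorem exists_norm_le_essSup {f : ℝ → L2 Ω} (hf : MemLp f ⊤ (volume.restrict (Ici 0)))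
    {a b : ℝ} (ha : 0 ≤ a) (hab : a < b) :
    ∃ s ∈ Ioo a b, ‖f s‖ ≤ (eLpNorm f ⊤ (volume.restrict (Ici 0))).toReal := by
  have h := ae_restrict_of_ae_restrict_of_subset
    (fun x hx => ha.trans hx.1.le : Ioo a b ⊆ Ici 0) (ae_norm_le_essSup hf)
  have : (ae (volume.restrict (Ioo a b))).NeBot := by
    rw [ae_neBot, Ne, Measure.restrict_eq_zero, Real.volume_Ioo]
    simpa using hab
  obtain ⟨s, hs, hs'⟩ := ((ae_restrict_mem measurableSet_Ioo).and h).exists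
  exact ⟨s, hs, hs'⟩

/-- The values f(r 0) and f(r n) may exceed the essential supremum. So the partition is extended by
a point on each side where f does not, and the two extra jumps are charged to the variation. -/
theorem norm_add_sum_norm_sub_le_sourceConst {f : ℝ → L2 Ω}
    (hf : MemLp f ⊤ (volume.restrict (Ici 0))) (hBV : BoundedVariationOn f (Ici 0))
    {r : ℕ → ℝ} (hr : Monotone r) (hr0 : 0 < r 0) (n : ℕ) :
    ‖f (r 0)‖ + ∑ k ∈ Finset.range n, ‖f (r (k + 1)) - f (r k)‖ + ‖f (r n)‖ ≤
      sourceConst f := by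
  obtain ⟨a, ha, hfa⟩ := exists_norm_le_essSup hf le_rfl hr0
  obtain ⟨b, hb, hfb⟩ := exists_norm_le_essSup hf (hr0.le.trans (hr (Nat.zero_le n)))
    (lt_add_one (r n))
  -- The extended partition a, r 0, …, r n, b.
  let v : ℕ → ℝ := fun i => if i = 0 then a else if i ≤ n + 1 then r (i - 1) else b
  have hv : MonotoneOn v (Iic (n + 2)) := by
    intro i _ j _ hij
    simp only [v]
    split_ifs with h1 h2 h3 h4 h5 h6 h7
    · exact le_rfl
    · exact ha.2.le.trans (hr (Nat.zero_le _))
    · exact (ha.2.le.trans (hr (Nat.zero_le n))).trans hb.1.le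
    · omega
    · exact hr (by omega)
    · exact (hr (by omega)).trans hb.1.le
    · omega
    · omega
    · exact le_rfl
  have hv0 : ∀ i ≤ n + 2, v i ∈ Ici (0 : ℝ) := by
    intro i _
    simp only [v, mem_Ici]
    split_ifs
    · exact ha.1.le
    · exact hr0.le.trans (hr (Nat.zero_le _))
    · exact (hr0.le.trans (hr (Nat.zero_le _))).trans hb.1.le
  have h := eVariationOn.sum_le_of_monotoneOn_Iic (f := f) hv hv0
  have h' := ENNReal.toReal_mono hBV h
  rw [ENNReal.toReal_sum fun i _ => edist_ne_top _ _, Finset.sum_range_succ,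
    Finset.sum_range_succ'] at h'
  simp only [← dist_edist, dist_eq_norm] at h'
  have hs : ∑ k ∈ Finset.range n, ‖f (v (k + 1 + 1)) - f (v (k + 1))‖ =
      ∑ k ∈ Finset.range n, ‖f (r (k + 1)) - f (r k)‖ := by
    refine Finset.sum_congr rfl fun k hk => ?_
    have := Finset.mem_range.1 hk
    simp [v, show k + 1 ≤ n by omega, this.le]
  have e1 : v 0 = a := by simp [v]
  have e2 : v (0 + 1) = r 0 := by simp [v]
  have e3 : v (n + 1) = r n := by simp [v]
  have e4 : v (n + 1 + 1) = b := by simp [v]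
  rw [hs, e1, e2, e3, e4] at h'
  have h1 : ‖f (r 0)‖ ≤ ‖f a‖ + ‖f (r 0) - f a‖ := by
    simpa using norm_add_le (f a) (f (r 0) - f a)
  have h2 : ‖f (r n)‖ ≤ ‖f b‖ + ‖f b - f (r n)‖ := by
    simpa using norm_sub_le (f b) (f b - f (r n))
  rw [sourceConst]
  linarith

/-- Summation by parts of a source term of bounded variation against increments. -/
theorem sum_inner_sub_le {f : ℝ → L2 Ω}
    (hf : MemLp f ⊤ (volume.restrict (Ici 0))) (hBV : BoundedVariationOn f (Ici 0))
    {r : ℕ → ℝ} (hr : Monotone r) (hr0 : 0 < r 0) (w : ℕ → L2 Ω) {B : ℝ} (n : ℕ)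
    (hw : ∀ k ≤ n + 1, ‖w k‖ ≤ B) :
    ∑ k ∈ Finset.range (n + 1), inner ℝ (f (r k)) (w (k + 1) - w k) ≤ sourceConst f * B := by
  have hB : 0 ≤ B := (norm_nonneg _).trans (hw 0 (Nat.zero_le _))
  have hi : ∀ (g : L2 Ω) (k : ℕ), k ≤ n + 1 → |inner ℝ g (w k)| ≤ ‖g‖ * B := fun g k hk =>
    (abs_real_inner_le_norm _ _).trans (mul_le_mul_of_nonneg_left (hw k hk) (norm_nonneg _))
  have key : ∀ m, ∑ k ∈ Finset.range (m + 1), inner ℝ (f (r k)) (w (k + 1) - w k) =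
      inner ℝ (f (r m)) (w (m + 1)) - inner ℝ (f (r 0)) (w 0) -
        ∑ k ∈ Finset.range m, inner ℝ (f (r (k + 1)) - f (r k)) (w (k + 1)) := by
    intro m
    induction m with
    | zero => simp [inner_sub_right]
    | succ m ih =>
      rw [Finset.sum_range_succ, ih, Finset.sum_range_succ _ m, inner_sub_right, inner_sub_left]
      ring
  have h1 := le_of_abs_le (hi (f (r n)) (n + 1) le_rfl)
  have h2 := neg_le_of_abs_le (hi (f (r 0)) 0 (Nat.zero_le _))
  have h3 : -∑ k ∈ Finset.range n, inner ℝ (f (r (k + 1)) - f (r k)) (w (k + 1)) ≤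
      (∑ k ∈ Finset.range n, ‖f (r (k + 1)) - f (r k)‖) * B := by
    rw [← Finset.sum_neg_distrib, Finset.sum_mul]
    refine Finset.sum_le_sum fun k hk => ?_
    have := neg_le_of_abs_le (hi (f (r (k + 1)) - f (r k)) (k + 1)
      (by have := Finset.mem_range.1 hk; omega))
    linarith
  have h4 := mul_le_mul_of_nonneg_right
    (norm_add_sum_norm_sub_le_sourceConst hf hBV hr hr0 n) hB
  rw [key]
  linarith

end Source

/-! ### History coefficients for a single exponential and their monotonicity -/

section Coefficients

/-- The contribution of the cell `[t_{j-1}, t_j]` to the coefficient of the increment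
`u^{j+1} - u^j`, for the kernel `exp (θ s)`. -/
noncomputable def skewCoef (θ : ℝ) (t : ℕ → ℝ) : ℕ → ℝ
  -- No cell precedes the first increment.
  | 0 => 0
  | j + 1 => expSkew θ (t j) (t (j + 1)) / ((t (j + 2) - t j) * (t (j + 2) - t (j + 1)))

/-- The coefficient of the increment `u^{j+1} - u^j` in the history term with the kernel
`exp (θ s)`. -/
noncomputable def histCoef (θ : ℝ) (t : ℕ → ℝ) (j : ℕ) : ℝ :=
  expMass θ (t j) (t (j + 1)) / (t (j + 1) - t j) -
    expSkew θ (t j) (t (j + 1)) / ((t (j + 2) - t j) * (t (j + 1) - t j)) + skewCoef θ t j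

/-- The increments of `histCoef`. -/
noncomputable def histIncr (θ : ℝ) (t : ℕ → ℝ) : ℕ → ℝ
  -- The first coefficient counts as an increment from 0, so partial sums recover `histCoef`.
  | 0 => histCoef θ t 0
  | j + 1 => histCoef θ t (j + 1) - histCoef θ t j

theorem sum_histIncr (θ : ℝ) (t : ℕ → ℝ) (j : ℕ) :
    ∑ i ∈ Finset.range (j + 1), histIncr θ t i = histCoef θ t j := by
  induction j with
  | zero => simp [histIncr]
  | succ j ih => rw [Finset.sum_range_succ, ih, histIncr]; ring

variable {θ η : ℝ} {t : ℕ → ℝ}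

theorem skewCoef_nonneg (hθ : 0 ≤ θ) (ht : StrictMono t) (j : ℕ) : 0 ≤ skewCoef θ t j := by
  cases j with
  | zero => exact le_rfl
  | succ j =>
    have h1 := ht (show j < j + 1 by omega)
    have h2 := ht (show j < j + 2 by omega)
    have h3 := ht (show j + 1 < j + 2 by omega)
    exact div_nonneg (expSkew_nonneg hθ h1.le)
      (mul_nonneg (sub_nonneg.2 h2.le) (sub_nonneg.2 h3.le))

/-- The equation for η is made for this bound: with consecutive steps a and b ≥ ηa it gives a³ ≤
3b²(a + b), which turns the cubic moment of the previous cell into half the current step. -/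
theorem skewCoef_le (hθ : 0 ≤ θ) (ht : StrictMono t) (hη0 : 0 < η)
    (hη : 1 - 3 * η ^ 2 * (1 + η) = 0)
    (hr : ∀ k, η * (t (k + 1) - t k) ≤ t (k + 2) - t (k + 1)) (j : ℕ) :
    skewCoef θ t j ≤ θ * Real.exp (θ * t j) * ((t (j + 1) - t j) / 2) := by
  cases j with
  | zero =>
    have := sub_pos.2 (ht (show 0 < 1 by omega))
    simp only [skewCoef]
    positivity
  | succ j =>
    have h1 := sub_pos.2 (ht (show j < j + 1 by omega))
    have h3 := sub_pos.2 (ht (show j + 1 < j + 2 by omega))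
    have hle := expSkew_le hθ (ht (show j < j + 1 by omega)).le
    have hrj := hr j
    simp only [skewCoef]
    set a := t (j + 1) - t j with ha
    set b := t (j + 2) - t (j + 1) with hb
    have hab : t (j + 2) - t j = a + b := by rw [ha, hb]; ring
    rw [hab, div_le_iff₀ (by positivity)]
    refine hle.trans ?_
    rw [mul_assoc (θ * _)]
    refine mul_le_mul_of_nonneg_left ?_ (by positivity)
    have h4 : (η * a) ^ 2 ≤ b ^ 2 := pow_le_pow_left₀ (by positivity) hrj 2
    have h5 : (η * a) ^ 2 * (a + η * a) ≤ b ^ 2 * (a + b) :=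
      mul_le_mul h4 (by linarith) (by positivity) (by positivity)
    have h6 : a ^ 3 = 3 * ((η * a) ^ 2 * (a + η * a)) := by
      linear_combination a ^ 3 * hη
    rw [h6]
    linarith

/-- Replacing t_{j+2} - t_j by the smaller t_{j+1} - t_j only enlarges the subtracted term; the
remaining weighted mean of e^{θs} is at least its value at the left end. -/
theorem exp_le_histCoef (hθ : 0 ≤ θ) (ht : StrictMono t) (j : ℕ) :
    Real.exp (θ * t j) ≤ histCoef θ t j := by
  have hj := ht (show j < j + 1 by omega)
  have h1 := sub_pos.2 hj
  have h3 := sub_pos.2 (ht (show j + 1 < j + 2 by omega))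
  have h4 := mul_exp_le_expMass_sub_expSkew hθ hj
  have h5 := expSkew_nonneg hθ hj.le
  have h6 := skewCoef_nonneg hθ ht j
  have h7 : expSkew θ (t j) (t (j + 1)) / ((t (j + 2) - t j) * (t (j + 1) - t j)) ≤
      expSkew θ (t j) (t (j + 1)) / (t (j + 1) - t j) / (t (j + 1) - t j) := by
    rw [div_div]
    refine div_le_div_of_nonneg_left h5 (by positivity) ?_
    exact mul_le_mul_of_nonneg_right (by linarith) h1.le
  have h8 : Real.exp (θ * t j) ≤ expMass θ (t j) (t (j + 1)) / (t (j + 1) - t j) -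
      expSkew θ (t j) (t (j + 1)) / (t (j + 1) - t j) / (t (j + 1) - t j) := by
    rw [← sub_div, le_div_iff₀ h1]
    linarith
  rw [histCoef]
  linarith

theorem histCoef_le (hθ : 0 ≤ θ) (ht : StrictMono t) (j : ℕ) :
    histCoef θ t j ≤ expMass θ (t j) (t (j + 1)) / (t (j + 1) - t j) + skewCoef θ t j := by
  have hj := ht (show j < j + 1 by omega)
  have h1 := sub_pos.2 hj
  have h3 := sub_pos.2 (ht (show j < j + 2 by omega))
  have h5 := expSkew_nonneg hθ hj.le
  have : 0 ≤ expSkew θ (t j) (t (j + 1)) / ((t (j + 2) - t j) * (t (j + 1) - t j)) := by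
    positivity
  rw [histCoef]
  linarith

/-- The spill-over from the previous cell fits exactly into the convexity surplus of
`expMass_add_le`. -/
theorem histCoef_le_exp (hθ : 0 ≤ θ) (ht : StrictMono t) (hη0 : 0 < η)
    (hη : 1 - 3 * η ^ 2 * (1 + η) = 0)
    (hr : ∀ k, η * (t (k + 1) - t k) ≤ t (k + 2) - t (k + 1)) (j : ℕ) :
    histCoef θ t j ≤ Real.exp (θ * t (j + 1)) := by
  have hj := ht (show j < j + 1 by omega)
  have h1 := sub_pos.2 hj
  refine (histCoef_le hθ ht j).trans ?_
  have h2 := skewCoef_le hθ ht hη0 hη hr j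
  have h3 := expMass_add_le hθ hj.le
  have h4 : expMass θ (t j) (t (j + 1)) / (t (j + 1) - t j) +
      θ * Real.exp (θ * t j) * ((t (j + 1) - t j) / 2) ≤ Real.exp (θ * t (j + 1)) := by
    rw [← le_sub_iff_add_le, div_le_iff₀ h1]
    linarith
  linarith

theorem histCoef_le_trapezoid (hθ : 0 ≤ θ) (ht : StrictMono t) (j : ℕ) :
    histCoef θ t j ≤
      (Real.exp (θ * t j) + Real.exp (θ * t (j + 1))) / 2 + skewCoef θ t j := by
  have hj := ht (show j < j + 1 by omega)
  refine (histCoef_le hθ ht j).trans (add_le_add_left ?_ _)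
  rw [div_le_iff₀ (sub_pos.2 hj)]
  linarith [expMass_le_trapezoid hθ hj.le]

theorem histIncr_nonneg (hθ : 0 ≤ θ) (ht : StrictMono t) (hη0 : 0 < η)
    (hη : 1 - 3 * η ^ 2 * (1 + η) = 0)
    (hr : ∀ k, η * (t (k + 1) - t k) ≤ t (k + 2) - t (k + 1)) (j : ℕ) :
    0 ≤ histIncr θ t j := by
  cases j with
  | zero => exact (Real.exp_nonneg _).trans (exp_le_histCoef hθ ht 0)
  | succ j =>
    exact sub_nonneg.2 ((histCoef_le_exp hθ ht hη0 hη hr j).trans (exp_le_histCoef hθ ht (j + 1)))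

end Coefficients

/-! ### The fast operator as a combination of increments -/

section Representation

variable {V : Type*} [NormedAddCommGroup V] [NormedSpace ℝ V]
variable {α : ℝ} {Nq : ℕ} {θ ϖ : Fin Nq → ℝ} {t : ℕ → ℝ}

theorem continuous_expSum (θ ϖ : Fin Nq → ℝ) : Continuous (expSum θ ϖ) := by
  unfold expSum
  fun_prop

theorem integral_expSum_mul_affine (θ ϖ : Fin Nq → ℝ) (T a b p r : ℝ) :
    ∫ s in a..b, expSum θ ϖ (T - s) * (p + r * (2 * s - a - b)) =
      ∑ l, ϖ l * Real.exp (-θ l * T) * (p * expMass (θ l) a b + r * expSkew (θ l) a b) := by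
  have h : ∀ s, expSum θ ϖ (T - s) * (p + r * (2 * s - a - b)) =
      ∑ l, ϖ l * Real.exp (-θ l * T) * (p * Real.exp (θ l * s) +
        r * ((2 * s - a - b) * Real.exp (θ l * s))) := by
    intro s
    rw [expSum, Finset.sum_mul]
    refine Finset.sum_congr rfl fun l _ => ?_
    rw [show -θ l * (T - s) = -θ l * T + θ l * s by ring, Real.exp_add]
    ring
  simp_rw [h]
  rw [intervalIntegral.integral_finsetSum
    fun l _ => Continuous.intervalIntegrable (by fun_prop) _ _]
  refine Finset.sum_congr rfl fun l _ => ?_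
  rw [intervalIntegral.integral_const_mul,
    intervalIntegral.integral_add (Continuous.intervalIntegrable (by fun_prop) _ _)
      (Continuous.intervalIntegrable (by fun_prop) _ _),
    intervalIntegral.integral_const_mul, intervalIntegral.integral_const_mul, expMass, expSkew]

theorem deriv_interp1 (ht : StrictMono t) (u : ℕ → V) (k : ℕ) (s : ℝ) :
    deriv (interp1 t u (k + 1)) s = (1 / (t (k + 1) - t k)) • (u (k + 1) - u k) := by
  have h1 := sub_ne_zero.2 (ht (show k < k + 1 by omega)).ne'
  have h2 := sub_ne_zero.2 (ht (show k < k + 1 by omega)).ne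
  have h : HasDerivAt (interp1 t u (k + 1))
      ((1 / (t k - t (k + 1))) • u k + (1 / (t (k + 1) - t k)) • u (k + 1)) s :=
    ((((hasDerivAt_id s).sub_const _).div_const _).smul_const _).add
      ((((hasDerivAt_id s).sub_const _).div_const _).smul_const _)
  rw [h.deriv]
  match_scalars <;> field_simp
  ring

/-- The coefficients are written as p + r(2s - a - b), zero constant included, to match
`integral_expSum_mul_affine`. -/
theorem deriv_interp2 (ht : StrictMono t) (u : ℕ → V) (i : ℕ) (s : ℝ) :
    deriv (interp2 t u (i + 1)) s =
      (1 / (t (i + 1) - t i) + -(1 / ((t (i + 2) - t i) * (t (i + 1) - t i))) *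
        (2 * s - t i - t (i + 1))) • (u (i + 1) - u i) +
      (0 + 1 / ((t (i + 2) - t i) * (t (i + 2) - t (i + 1))) *
        (2 * s - t i - t (i + 1))) • (u (i + 2) - u (i + 1)) := by
  have h1 := sub_ne_zero.2 (ht (show i < i + 1 by omega)).ne'
  have h1' := sub_ne_zero.2 (ht (show i < i + 1 by omega)).ne
  have h2 := sub_ne_zero.2 (ht (show i < i + 2 by omega)).ne'
  have h2' := sub_ne_zero.2 (ht (show i < i + 2 by omega)).ne
  have h3 := sub_ne_zero.2 (ht (show i + 1 < i + 2 by omega)).ne'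
  have h3' := sub_ne_zero.2 (ht (show i + 1 < i + 2 by omega)).ne
  have hm : ∀ (p q c : ℝ) (v : V), HasDerivAt (fun s : ℝ => ((s - p) * (s - q) / c) • v)
      (((2 * s - p - q) / c) • v) s := by
    intro p q c v
    have := (((((hasDerivAt_id s).sub_const p).mul
      ((hasDerivAt_id s).sub_const q)).div_const c).smul_const v)
    refine this.congr_deriv ?_
    congr 2
    simp only [id]
    ring
  have h : HasDerivAt (interp2 t u (i + 1)) _ s :=
    ((hm (t (i + 1)) (t (i + 2)) ((t i - t (i + 1)) * (t i - t (i + 2))) (u i)).add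
      (hm (t i) (t (i + 2)) ((t (i + 1) - t i) * (t (i + 1) - t (i + 2))) (u (i + 1)))).add
      (hm (t i) (t (i + 1)) ((t (i + 2) - t i) * (t (i + 2) - t (i + 1))) (u (i + 2)))
  rw [h.deriv]
  match_scalars <;> field_simp <;> ring

theorem integral_expSum_smul_deriv_interp2 [CompleteSpace V] (θ ϖ : Fin Nq → ℝ) (ht : StrictMono t) (u : ℕ → V)
    (T : ℝ) (i : ℕ) :
    ∫ s in t i..t (i + 1), expSum θ ϖ (T - s) • deriv (interp2 t u (i + 1)) s =
      (∑ l, ϖ l * Real.exp (-θ l * T) * (histCoef (θ l) t i - skewCoef (θ l) t i)) •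
          (u (i + 1) - u i) +
        (∑ l, ϖ l * Real.exp (-θ l * T) * skewCoef (θ l) t (i + 1)) •
          (u (i + 2) - u (i + 1)) := by
  have hc := continuous_expSum θ ϖ
  simp_rw [deriv_interp2 ht, smul_add, smul_smul]
  rw [intervalIntegral.integral_add (Continuous.intervalIntegrable (by fun_prop) _ _)
    (Continuous.intervalIntegrable (by fun_prop) _ _),
    intervalIntegral.integral_smul_const, intervalIntegral.integral_smul_const,
    integral_expSum_mul_affine, integral_expSum_mul_affine]
  congr 2
  · refine Finset.sum_congr rfl fun l _ => ?_
    rw [histCoef]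
    ring
  · refine Finset.sum_congr rfl fun l _ => ?_
    rw [skewCoef]
    ring

/-- The diagonal coefficient of the fast L2-1σ operator, up to the factor `Γ(1-α)`. -/
noncomputable def diagCoef (α : ℝ) (θ ϖ : Fin Nq → ℝ) (t : ℕ → ℝ) (k : ℕ) : ℝ :=
  sig α / (1 - α) * (sig α * (t (k + 1) - t k)) ^ (-α) +
    ∑ l, ϖ l * Real.exp (-θ l * tStar α t (k + 1)) * skewCoef (θ l) t k

theorem integral_rpow_tStar_sub (hα0 : 0 < α) (hα1 : α < 1) (ht : StrictMono t) (k : ℕ) :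
    ∫ s in t k..tStar α t (k + 1), (tStar α t (k + 1) - s) ^ (-α) =
      sig α / (1 - α) * (sig α * (t (k + 1) - t k)) ^ (-α) * (t (k + 1) - t k) := by
  have h1 := sub_pos.2 (ht (show k < k + 1 by omega))
  have hs : 0 < sig α := by unfold sig; linarith
  have h2 : tStar α t (k + 1) - t k = sig α * (t (k + 1) - t k) := by
    simp [tStar, step]
  have h3 : 0 < sig α * (t (k + 1) - t k) := by positivity
  rw [intervalIntegral.integral_comp_sub_left (fun x => x ^ (-α)), sub_self, h2,
    integral_rpow (Or.inl (by linarith)), Real.zero_rpow (by linarith), Real.rpow_add h3,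
    Real.rpow_one]
  have : 1 - α ≠ 0 := by linarith
  have h4 : -α + 1 ≠ 0 := by linarith
  field_simp
  ring

theorem sum_add_shift (a s : ℕ → ℝ) (x : ℕ → V) (hs : s 0 = 0) (k : ℕ) :
    ∑ i ∈ Finset.range k, ((a i - s i) • x i + s (i + 1) • x (i + 1)) =
      ∑ i ∈ Finset.range k, a i • x i + s k • x k := by
  induction k with
  | zero => simp [hs]
  | succ k ih =>
    rw [Finset.sum_range_succ, ih, Finset.sum_range_succ]
    module

/-- Each history cell feeds its own increment and the next one. Regrouping by increment leaves the
last spill-over on the diagonal, next to the singular local integral. -/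
theorem fastL21_succ [CompleteSpace V] (hα0 : 0 < α) (hα1 : α < 1) (θ ϖ : Fin Nq → ℝ) (ht : StrictMono t)
    (u : ℕ → V) (k : ℕ) :
    fastL21 α θ ϖ t u (k + 1) = (Real.Gamma (1 - α))⁻¹ •
      (∑ j ∈ Finset.range k, (∑ l, ϖ l * Real.exp (-θ l * tStar α t (k + 1)) *
          histCoef (θ l) t j) • (u (j + 1) - u j) +
        diagCoef α θ ϖ t k • (u (k + 1) - u k)) := by
  have h1 := sub_ne_zero.2 (ht (show k < k + 1 by omega)).ne'
  have hshift : ∀ (g : ℕ → V) (n : ℕ),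
      ∑ j ∈ Finset.Icc 1 n, g j = ∑ i ∈ Finset.range n, g (i + 1) := by
    intro g n
    induction n with
    | zero => simp
    | succ n ih => rw [Finset.sum_Icc_succ_top (by omega), ih, Finset.sum_range_succ]
  rw [fastL21]
  congr 1
  rw [Nat.add_sub_cancel, hshift]
  simp only [Nat.add_sub_cancel]
  simp_rw [integral_expSum_smul_deriv_interp2 θ ϖ ht u, deriv_interp1 ht,
    intervalIntegral.integral_smul_const, integral_rpow_tStar_sub hα0 hα1 ht k]
  have h := sum_add_shift
    (fun i => ∑ l, ϖ l * Real.exp (-θ l * tStar α t (k + 1)) * histCoef (θ l) t i)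
    (fun i => ∑ l, ϖ l * Real.exp (-θ l * tStar α t (k + 1)) * skewCoef (θ l) t i)
    (fun i => u (i + 1) - u i) (by simp [skewCoef]) k
  simp only [← Finset.sum_sub_distrib, ← mul_sub] at h
  rw [h, diagCoef, smul_smul, add_smul]
  have h2 : ∀ c : ℝ, c * (t (k + 1) - t k) * (1 / (t (k + 1) - t k)) = c := by
    intro c; field_simp
  rw [h2]
  abel

end Representation

/-! ### Diagonal dominance and positivity of the fast operator -/

section Positivity

variable {α η ε Δt Tsoe : ℝ} {Nq : ℕ} {θ ϖ : Fin Nq → ℝ} {t : ℕ → ℝ}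

theorem IsAdmissibleMesh.strictMono (ht : IsAdmissibleMesh α η ε Δt Tsoe t) : StrictMono t :=
  strictMono_nat_of_lt_succ ht.lt_succ

theorem IsAdmissibleMesh.mul_step_le (ht : IsAdmissibleMesh α η ε Δt Tsoe t) (k : ℕ) :
    η * (t (k + 1) - t k) ≤ t (k + 2) - t (k + 1) := by
  have h := ht.ratio (k + 2) (by omega)
  exact (le_div_iff₀ (sub_pos.2 (ht.lt_succ k))).1 h

theorem IsSOE.expSum_step_le (hα0 : 0 < α) (hα1 : α < 1) (hs : IsSOE α ε Δt Tsoe θ ϖ)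
    (ht : IsAdmissibleMesh α η ε Δt Tsoe t) (k : ℕ) :
    expSum θ ϖ (sig α * (t (k + 2) - t (k + 1))) ≤
      (sig α * (t (k + 2) - t (k + 1))) ^ (-α) + ε := by
  have h1 : Δt ≤ sig α * (t (k + 2) - t (k + 1)) := ht.cutoff_le (k + 2) (by omega)
  have h2 : sig α * (t (k + 3) - t (k + 2)) + (t (k + 2) - t (k + 1)) ≤ Tsoe :=
    ht.le_soe (k + 2) (by omega)
  have hσ : 0 < sig α := by unfold sig; linarith
  have hσ1 : sig α ≤ 1 := by unfold sig; linarith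
  have h3 := mul_pos hσ (sub_pos.2 (ht.lt_succ (k + 2)))
  have h4 := mul_le_mul_of_nonneg_right hσ1 (sub_pos.2 (ht.lt_succ (k + 1))).le
  have h5 := hs.approx _ ⟨h1, by
    change 0 < sig α * (t (k + 3) - t (k + 2)) at h3
    change sig α * (t (k + 2) - t (k + 1)) ≤ 1 * (t (k + 2) - t (k + 1)) at h4
    linarith⟩
  linarith [neg_le_of_abs_le h5]

/-- Steps shrink by at most the factor η, and Bernoulli's inequality makes η^{-α} linear in α. -/
theorem step_rpow_le (hα0 : 0 < α) (hα1 : α < 1) (hη0 : 0 < η)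
    (hη : 1 - 3 * η ^ 2 * (1 + η) = 0) (ht : IsAdmissibleMesh α η ε Δt Tsoe t) (k : ℕ) :
    (sig α * (t (k + 2) - t (k + 1))) ^ (-α) ≤
      (1 + 6 / 5 * α) * (sig α * (t (k + 1) - t k)) ^ (-α) := by
  have hσ : 0 < sig α := by unfold sig; linarith
  have h1 : 0 < t (k + 1) - t k := sub_pos.2 (ht.lt_succ k)
  have h2 : η * (sig α * (t (k + 1) - t k)) ≤ sig α * (t (k + 2) - t (k + 1)) := by
    have := mul_le_mul_of_nonneg_left (ht.mul_step_le k) hσ.le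
    linarith
  have h3 := Real.rpow_le_rpow_of_nonpos (z := -α) (by positivity) h2 (by linarith)
  rw [Real.mul_rpow hη0.le (by positivity)] at h3
  refine h3.trans (mul_le_mul_of_nonneg_right ?_ (by positivity))
  -- A rational lower bound for η chosen so that η⁻¹ ≤ 1 + 6/5.
  have h4 : 5 / 11 ≤ η := by
    by_contra! h
    nlinarith [mul_pos hη0 hη0]
  rw [Real.rpow_neg hη0.le, ← Real.inv_rpow hη0.le]
  have h5 : η⁻¹ ≤ 1 + 6 / 5 := by
    rw [inv_le_comm₀ hη0 (by norm_num)]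
    norm_num
    exact h4
  refine (Real.rpow_le_rpow (by positivity) h5 hα0.le).trans ?_
  refine (rpow_one_add_le_one_add_mul_self (by norm_num) hα0.le hα1.le).trans_eq ?_
  ring

theorem tol_le_rpow (hα0 : 0 < α) (hα1 : α < 1) (ht : IsAdmissibleMesh α η ε Δt Tsoe t)
    (k : ℕ) : ε ≤ (sig α * (t (k + 1) - t k)) ^ (-α) / (5 * (1 - α)) := by
  have hσ : 0 < sig α := by unfold sig; linarith
  have h1 : 0 < t (k + 1) - t k := sub_pos.2 (ht.lt_succ k)
  refine (ht.tol_le (k + 1) (by omega)).trans_eq ?_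
  rw [Real.rpow_neg (by positivity)]
  simp only [step, Nat.add_sub_cancel]
  have : 1 - α ≠ 0 := by linarith
  field_simp

theorem sum_mul_exp_eq_expSum (θ ϖ : Fin Nq → ℝ) (T s : ℝ) :
    ∑ l, ϖ l * Real.exp (-θ l * T) * Real.exp (θ l * s) = expSum θ ϖ (T - s) := by
  refine Finset.sum_congr rfl fun l _ => ?_
  rw [mul_assoc, ← Real.exp_add]
  ring_nf

theorem tStar_succ_sub (α : ℝ) (t : ℕ → ℝ) (k : ℕ) :
    tStar α t (k + 1) - t k = sig α * (t (k + 1) - t k) := by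
  simp [tStar, step]

theorem tStar_succ_strictMono (hα0 : 0 < α) (hα1 : α < 1) (ht : StrictMono t) :
    StrictMono fun k => tStar α t (k + 1) := by
  refine strictMono_nat_of_lt_succ fun k => ?_
  have hσ : 0 < sig α := by unfold sig; linarith
  have hσ1 : sig α ≤ 1 := by unfold sig; linarith
  have h1 := sub_pos.2 (ht (show k < k + 1 by omega))
  have h2 := sub_pos.2 (ht (show k + 1 < k + 2 by omega))
  have e1 := tStar_succ_sub α t k
  have e2 := tStar_succ_sub α t (k + 1)
  have h3 := mul_le_mul_of_nonneg_right hσ1 h1.le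
  have h4 : 0 < sig α * (t (k + 1 + 1) - t (k + 1)) := mul_pos hσ h2
  linarith

theorem hist_zero_le_diagCoef (hα0 : 0 < α) (hα1 : α < 1) (hη0 : 0 < η)
    (hη : 1 - 3 * η ^ 2 * (1 + η) = 0) (hs : IsSOE α ε Δt Tsoe θ ϖ)
    (ht : IsAdmissibleMesh α η ε Δt Tsoe t) :
    ∑ l, ϖ l * Real.exp (-θ l * tStar α t 2) * histCoef (θ l) t 0 ≤
      2 * diagCoef α θ ϖ t 0 := by
  have hσ : 0 < sig α := by unfold sig; linarith
  have h1 : 0 < t 1 - t 0 := sub_pos.2 (ht.lt_succ 0)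
  have hα : 0 < 1 - α := by linarith
  have h2 : ∑ l, ϖ l * Real.exp (-θ l * tStar α t 2) * histCoef (θ l) t 0 ≤
      expSum θ ϖ (sig α * (t 2 - t 1)) := by
    rw [← tStar_succ_sub α t 1, ← sum_mul_exp_eq_expSum]
    refine Finset.sum_le_sum fun l _ => mul_le_mul_of_nonneg_left ?_
      (mul_nonneg (hs.weight_pos l).le (Real.exp_nonneg _))
    exact histCoef_le_exp (hs.node_pos l).le ht.strictMono hη0 hη ht.mul_step_le 0
  have h3 := hs.expSum_step_le hα0 hα1 ht 0
  have h4 := step_rpow_le hα0 hα1 hη0 hη ht 0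
  have h5 := tol_le_rpow hα0 hα1 ht 0
  simp only [zero_add] at h3 h4 h5
  have h6 : 2 * diagCoef α θ ϖ t 0 =
      (2 - α) / (1 - α) * (sig α * (t 1 - t 0)) ^ (-α) := by
    simp only [diagCoef, skewCoef, sig]
    simp
    ring
  have hR : 0 < (sig α * (t 1 - t 0)) ^ (-α) := by positivity
  -- Left: kernel ratio plus tolerance. Right: twice the local diagonal weight, since 2σ = 2 - α.
  have h7 : 1 + 6 / 5 * α + 1 / (5 * (1 - α)) ≤ (2 - α) / (1 - α) := by
    rw [← sub_nonneg]
    have : (2 - α) / (1 - α) - (1 + 6 / 5 * α + 1 / (5 * (1 - α))) =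
        (4 / 5 - 6 / 5 * (α * (1 - α))) / (1 - α) := by
      field_simp
      ring
    rw [this]
    refine div_nonneg ?_ hα.le
    nlinarith [sq_nonneg (2 * α - 1)]
  have h8 := mul_le_mul_of_nonneg_right h7 hR.le
  have h9 : (sig α * (t 1 - t 0)) ^ (-α) / (5 * (1 - α)) =
      1 / (5 * (1 - α)) * (sig α * (t 1 - t 0)) ^ (-α) := by ring
  rw [h6]
  linarith

theorem hist_succ_le_diagCoef (hα0 : 0 < α) (hα1 : α < 1) (hη0 : 0 < η)
    (hη : 1 - 3 * η ^ 2 * (1 + η) = 0) (hs : IsSOE α ε Δt Tsoe θ ϖ)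
    (ht : IsAdmissibleMesh α η ε Δt Tsoe t) (m : ℕ) :
    ∑ l, ϖ l * Real.exp (-θ l * tStar α t (m + 2)) * histCoef (θ l) t m +
      ∑ l, ϖ l * Real.exp (-θ l * tStar α t (m + 3)) *
        (histCoef (θ l) t (m + 1) - histCoef (θ l) t m) ≤
      2 * diagCoef α θ ϖ t (m + 1) := by
  have hσ : 0 < sig α := by unfold sig; linarith
  have h1 : 0 < t (m + 2) - t (m + 1) := sub_pos.2 (ht.lt_succ (m + 1))
  have hα : 0 < 1 - α := by linarith
  have hsm := ht.strictMono
  have hT : tStar α t (m + 2) ≤ tStar α t (m + 3) :=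
    (tStar_succ_strictMono hα0 hα1 hsm).monotone (show m + 1 ≤ m + 2 by omega)
  set P := ∑ l, ϖ l * Real.exp (-θ l * tStar α t (m + 2)) * skewCoef (θ l) t (m + 1) with hP
  have hP0 : 0 ≤ P := Finset.sum_nonneg fun l _ =>
    mul_nonneg (mul_nonneg (hs.weight_pos l).le (Real.exp_nonneg _))
      (skewCoef_nonneg (hs.node_pos l).le hsm _)
  have h2 : ∑ l, ϖ l * Real.exp (-θ l * tStar α t (m + 2)) * histCoef (θ l) t m +
      ∑ l, ϖ l * Real.exp (-θ l * tStar α t (m + 3)) *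
        (histCoef (θ l) t (m + 1) - histCoef (θ l) t m) ≤
      expSum θ ϖ (sig α * (t (m + 2) - t (m + 1))) +
        expSum θ ϖ (sig α * (t (m + 3) - t (m + 2))) / 2 + P := by
    rw [← tStar_succ_sub α t (m + 1), ← tStar_succ_sub α t (m + 2), ← sum_mul_exp_eq_expSum,
      ← sum_mul_exp_eq_expSum, Finset.sum_div, hP, ← Finset.sum_add_distrib,
      ← Finset.sum_add_distrib, ← Finset.sum_add_distrib]
    refine Finset.sum_le_sum fun l _ => ?_
    have hθ := (hs.node_pos l).le
    have hw := (hs.weight_pos l).le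
    have hp : ϖ l * Real.exp (-θ l * tStar α t (m + 3)) ≤
        ϖ l * Real.exp (-θ l * tStar α t (m + 2)) :=
      mul_le_mul_of_nonneg_left (Real.exp_le_exp.2 (by nlinarith)) hw
    have hp0 : 0 ≤ ϖ l * Real.exp (-θ l * tStar α t (m + 3)) :=
      mul_nonneg hw (Real.exp_nonneg _)
    have e1 := histCoef_le_exp hθ hsm hη0 hη ht.mul_step_le m
    -- The trapezoid bound charges only half of the next step's exponential sum, and its left half
    -- is offset by the bound for `histCoef m`. The leftover `skewCoef` is paid by the diagonal.
    have e2 := histCoef_le_trapezoid hθ hsm (m + 1)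
    have e3 := skewCoef_nonneg hθ hsm (m + 1)
    -- With row weights p ≥ q, the sum pH_m + q(H_{m+1} - H_m) is regrouped as (p - q)H_m +
    -- qH_{m+1}, so only upper bounds on H are needed.
    have f1 := mul_le_mul_of_nonneg_left e1 (sub_nonneg.2 hp)
    have f2 := mul_le_mul_of_nonneg_left e2 hp0
    have f3 := mul_le_mul_of_nonneg_right hp e3
    have f4 := mul_nonneg hp0 (Real.exp_nonneg (θ l * t (m + 1)))
    have e4 : m + 1 + 1 = m + 2 := rfl
    have e5 : m + 2 + 1 = m + 3 := rfl
    simp only [e4, e5] at f2 ⊢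
    linarith
  have h3 := hs.expSum_step_le hα0 hα1 ht m
  have h3' := hs.expSum_step_le hα0 hα1 ht (m + 1)
  have h4 := step_rpow_le hα0 hα1 hη0 hη ht (m + 1)
  have h5 := tol_le_rpow hα0 hα1 ht (m + 1)
  simp only [show m + 1 + 1 = m + 2 from rfl, show m + 1 + 2 = m + 3 from rfl] at h3' h4 h5
  set R := (sig α * (t (m + 2) - t (m + 1))) ^ (-α) with hRdef
  have h6 : 2 * diagCoef α θ ϖ t (m + 1) = (2 - α) / (1 - α) * R + 2 * P := by
    rw [diagCoef, hRdef, hP, sig]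
    ring
  have hR : 0 < R := by positivity
  have h7 : 1 + (1 + 6 / 5 * α) / 2 + 3 / 2 * (1 / (5 * (1 - α))) ≤ (2 - α) / (1 - α) := by
    rw [← sub_nonneg]
    have : (2 - α) / (1 - α) - (1 + (1 + 6 / 5 * α) / 2 + 3 / 2 * (1 / (5 * (1 - α)))) =
        (7 / 10 - (1 + 6 / 5 * α) * (1 - α) / 2) / (1 - α) := by
      field_simp
      ring
    rw [this]
    refine div_nonneg ?_ hα.le
    nlinarith [sq_nonneg α]
  have h8 := mul_le_mul_of_nonneg_right h7 hR.le
  have h9 : R / (5 * (1 - α)) = 1 / (5 * (1 - α)) * R := by ring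
  rw [h6]
  linarith

/-- The fast L2-1σ operator is positive semidefinite with respect to the increments. -/
theorem sum_inner_fastL21_nonneg {V : Type*} [NormedAddCommGroup V] [InnerProductSpace ℝ V]
    [CompleteSpace V] (hα0 : 0 < α) (hα1 : α < 1) (hη0 : 0 < η)
    (hη : 1 - 3 * η ^ 2 * (1 + η) = 0) (hs : IsSOE α ε Δt Tsoe θ ϖ)
    (ht : IsAdmissibleMesh α η ε Δt Tsoe t) (u : ℕ → V) (n : ℕ) :
    0 ≤ ∑ k ∈ Finset.range n, inner ℝ (fastL21 α θ ϖ t u (k + 1)) (u (k + 1) - u k) := by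
  have hsm := ht.strictMono
  -- Column differences of the coefficient matrix, nonnegative and decreasing in the row because
  -- each term is a product of a row factor and a column factor.
  let e : ℕ → ℕ → ℝ := fun k j =>
    ∑ l, ϖ l * Real.exp (-θ l * tStar α t (k + 1)) * histIncr (θ l) t j
  have hsum : ∀ k j, ∑ i ∈ Finset.range (j + 1), e k i =
      ∑ l, ϖ l * Real.exp (-θ l * tStar α t (k + 1)) * histCoef (θ l) t j := by
    intro k j
    rw [Finset.sum_comm]
    refine Finset.sum_congr rfl fun l _ => ?_
    rw [← Finset.mul_sum, sum_histIncr]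
  have hincr : ∀ l j, 0 ≤ histIncr (θ l) t j := fun l j =>
    histIncr_nonneg (hs.node_pos l).le hsm hη0 hη ht.mul_step_le j
  have hpos := lowerTriangular_form_nonneg e (fun k => 2 * diagCoef α θ ϖ t k)
    (fun k => u (k + 1) - u k)
    (fun k j _ => Finset.sum_nonneg fun l _ => mul_nonneg
      (mul_nonneg (hs.weight_pos l).le (Real.exp_nonneg _)) (hincr l j))
    (fun k j _ => Finset.sum_le_sum fun l _ => mul_le_mul_of_nonneg_right
      (mul_le_mul_of_nonneg_left (Real.exp_le_exp.2 (mul_le_mul_of_nonpos_left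
        ((tStar_succ_strictMono hα0 hα1 hsm).monotone k.le_succ)
        (neg_nonpos.2 (hs.node_pos l).le))) (hs.weight_pos l).le) (hincr l j))
    (fun k => by
      cases k with
      | zero => simpa [e, histIncr] using hist_zero_le_diagCoef hα0 hα1 hη0 hη hs ht
      | succ m =>
        rw [hsum]
        exact hist_succ_le_diagCoef hα0 hα1 hη0 hη hs ht m) n
  have hΓ : 0 < Real.Gamma (1 - α) := Real.Gamma_pos_of_pos (by linarith)
  have heq : ∑ k ∈ Finset.range n, inner ℝ (fastL21 α θ ϖ t u (k + 1)) (u (k + 1) - u k) =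
      (Real.Gamma (1 - α))⁻¹ / 2 * ∑ k ∈ Finset.range n,
        (2 * diagCoef α θ ϖ t k * ‖u (k + 1) - u k‖ ^ 2 + 2 * inner ℝ (u (k + 1) - u k)
          (∑ j ∈ Finset.range k, (∑ i ∈ Finset.range (j + 1), e k i) • (u (j + 1) - u j))) := by
    rw [Finset.mul_sum]
    refine Finset.sum_congr rfl fun k _ => ?_
    simp_rw [hsum]
    rw [fastL21_succ hα0 hα1 θ ϖ hsm, real_inner_smul_left, inner_add_left,
      real_inner_smul_left, real_inner_self_eq_norm_sq, real_inner_comm]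
    ring
  rw [heq]
  exact mul_nonneg (by positivity) hpos

end Positivity

/-! ### Energy estimate and the gradient bound -/

section Stability

variable {d : ℕ} {Ω : Set (Space d)}
variable {α η ε Δt Tsoe : ℝ} {Nq : ℕ} {θ ϖ : Fin Nq → ℝ} {t : ℕ → ℝ}

/-- The difference of the two sides is (1 - α)/2 · ‖g - h‖². -/
theorem norm_sq_sub_le_theta_form {V : Type*} [NormedAddCommGroup V] [InnerProductSpace ℝ V]
    (hα1 : α ≤ 1) (g h : V) :
    (‖g‖ ^ 2 - ‖h‖ ^ 2) / 2 ≤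
      (1 - α / 2) * inner ℝ g (g - h) + α / 2 * inner ℝ h (g - h) := by
  have h1 := norm_sub_sq_real g h
  have h2 := mul_nonneg (sub_nonneg.2 hα1) (sq_nonneg ‖g - h‖)
  rw [inner_sub_right, inner_sub_right, real_inner_self_eq_norm_sq, real_inner_self_eq_norm_sq,
    real_inner_comm g h]
  rw [h1] at h2
  linarith

theorem IsFastSolution.energy_le {f : ℝ → L2 Ω} {u0 : H10 Ω} {u : ℕ → H10 Ω}
    (hα0 : 0 < α) (hα1 : α < 1) (hη0 : 0 < η)
    (hη : 1 - 3 * η ^ 2 * (1 + η) = 0) (hs : IsSOE α ε Δt Tsoe θ ϖ)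
    (ht : IsAdmissibleMesh α η ε Δt Tsoe t) (hu : IsFastSolution α θ ϖ t f u0 u) (n : ℕ) :
    (‖H10.grad (u n)‖ ^ 2 - ‖H10.grad u0‖ ^ 2) / 2 ≤
      ∑ k ∈ Finset.range n,
        inner ℝ (f (tStar α t (k + 1))) (H10.fn (u (k + 1)) - H10.fn (u k)) := by
  have hpos := sum_inner_fastL21_nonneg hα0 hα1 hη0 hη hs ht (fun j => H10.fn (u j)) n
  have htel : (‖H10.grad (u n)‖ ^ 2 - ‖H10.grad u0‖ ^ 2) / 2 =
      ∑ k ∈ Finset.range n, (‖H10.grad (u (k + 1))‖ ^ 2 - ‖H10.grad (u k)‖ ^ 2) / 2 := by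
    rw [← Finset.sum_div, Finset.sum_range_sub (fun k => ‖H10.grad (u k)‖ ^ 2), hu.initial]
  rw [htel, ← sub_nonneg, ← Finset.sum_sub_distrib]
  refine hpos.trans (Finset.sum_le_sum fun k _ => ?_)
  have heq := hu.equation (k + 1) (by omega) (u (k + 1) - u k)
  have e1 : H10.fn (u (k + 1) - u k) = H10.fn (u (k + 1)) - H10.fn (u k) := rfl
  have e2 : H10.grad (u (k + 1) - u k) = H10.grad (u (k + 1)) - H10.grad (u k) := rfl
  rw [e1, e2, Nat.add_sub_cancel] at heq
  have := norm_sq_sub_le_theta_form hα1.le (H10.grad (u (k + 1))) (H10.grad (u k))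
  linarith

theorem IsFastSolution.norm_grad_le {f : ℝ → L2 Ω} {u0 : H10 Ω} {u : ℕ → H10 Ω} {C : ℝ}
    (hC : IsEmbeddingConstant Ω C) (hα0 : 0 < α) (hα1 : α < 1) (hη0 : 0 < η)
    (hη : 1 - 3 * η ^ 2 * (1 + η) = 0) (hs : IsSOE α ε Δt Tsoe θ ϖ)
    (ht : IsAdmissibleMesh α η ε Δt Tsoe t) (hf : MemLp f ⊤ (volume.restrict (Ici 0)))
    (hBV : BoundedVariationOn f (Ici 0)) (hu : IsFastSolution α θ ϖ t f u0 u) (n : ℕ) :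
    ‖H10.grad (u n)‖ ≤ ‖H10.grad u0‖ + 2 * sourceConst f * C := by
  obtain ⟨hC0, hCv⟩ := hC.1
  have hsrc : 0 ≤ sourceConst f := by
    unfold sourceConst
    positivity
  -- At the maximizing index, one norm controls all the values of u appearing in the source term.
  obtain ⟨m, hm, hmax⟩ := Finset.exists_max_image (Finset.range (n + 1))
    (fun k => ‖H10.grad (u k)‖) ⟨0, by simp⟩
  refine (hmax n (by simp)).trans ?_
  have h0 : ‖H10.grad u0‖ ≤ ‖H10.grad (u m)‖ := hu.initial ▸ hmax 0 (by simp)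
  cases m with
  | zero =>
    rw [hu.initial]
    have : 0 ≤ 2 * sourceConst f * C := by positivity
    linarith
  | succ m =>
    have hen := hu.energy_le hα0 hα1 hη0 hη hs ht (m + 1)
    have hr0 : 0 < tStar α t (0 + 1) := by
      have h1 := sub_pos.2 (ht.lt_succ 0)
      have h2 := tStar_succ_sub α t 0
      have hσ : 0 < sig α := by unfold sig; linarith
      rw [ht.zero] at h1 h2
      have := mul_pos hσ h1
      linarith
    have hsum := sum_inner_sub_le hf hBV (r := fun k => tStar α t (k + 1))
      (tStar_succ_strictMono hα0 hα1 ht.strictMono).monotone hr0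
      (fun k => H10.fn (u k)) (B := C * ‖H10.grad (u (m + 1))‖) m
      (fun k hk => (hCv (u k)).trans (mul_le_mul_of_nonneg_left
        (hmax k (by have := Finset.mem_range.1 hm; simp; omega)) hC0))
    by_contra! hlt
    set M := ‖H10.grad (u (m + 1))‖
    have hM : M ^ 2 ≤ ‖H10.grad u0‖ ^ 2 + 2 * sourceConst f * C * M := by linarith
    have hM0 : 0 < M := lt_of_le_of_lt (by positivity) hlt
    -- Trading one factor for M makes every term of the quadratic inequality divisible by M.
    have h3 : ‖H10.grad u0‖ ^ 2 ≤ ‖H10.grad u0‖ * M := by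
      rw [sq]
      exact mul_le_mul_of_nonneg_left h0 (norm_nonneg _)
    have h4 := mul_lt_mul_of_pos_right hlt hM0
    linarith

end Stability

end Subdiffusion

theorem theorem4p1 {d : ℕ} (hd : 1 ≤ d) (Ω : Set (Subdiffusion.Space d))
    (hΩ : IsOpen Ω) (hbdd : Bornology.IsBounded Ω) :
    ∃ CΩ : ℝ, Subdiffusion.IsEmbeddingConstant Ω CΩ ∧
      ∀ (α η ε Δt Tsoe : ℝ) (Nq : ℕ) (θ ϖ : Fin Nq → ℝ) (t : ℕ → ℝ)
        (f : ℝ → Subdiffusion.L2 Ω) (u0 : Subdiffusion.H10 Ω) (u : ℕ → Subdiffusion.H10 Ω),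
        0 < α → α < 1 →
        0 < η → 1 - 3 * η ^ 2 * (1 + η) = 0 →
        Subdiffusion.IsSOE α ε Δt Tsoe θ ϖ →
        Subdiffusion.IsAdmissibleMesh α η ε Δt Tsoe t →
        MeasureTheory.MemLp f ⊤ (MeasureTheory.volume.restrict (Set.Ici 0)) →
        BoundedVariationOn f (Set.Ici 0) →
        Subdiffusion.IsFastSolution α θ ϖ t f u0 u →
        ∀ n : ℕ, 1 ≤ n →
          ‖Subdiffusion.H10.grad (u n)‖ ≤
            ‖Subdiffusion.H10.grad u0‖ + 2 * Subdiffusion.sourceConst f * CΩ := by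
  obtain ⟨C, hC⟩ := Subdiffusion.exists_isEmbeddingConstant hd hbdd
  exact ⟨C, hC, fun α η ε Δt Tsoe Nq θ ϖ t f u0 u hα0 hα1 hη0 hη hs ht hf hBV hu n _ =>
    hu.norm_grad_le hC hα0 hα1 hη0 hη hs ht hf hBV n⟩
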